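/- A real Banach lattice is a complete normed real vector lattice whose norm is solid ($|x|\le|y|$ implies $\|x\|\le\|y\|$); a Banach lattice homomorphism is a bounded linear operator preserving $\vee$ and $\wedge$. For a norm-bounded lattice homomorphism $T$ from a lattice $\mathbb L$ into a Banach lattice put $\|T\|:=\sup_{x\in\mathbb L}\|T(x)\|$ ($0$ if $\mathbb L=\emptyset$). A free Banach lattice generated by a lattice $\mathbb L$ is a Banach lattice $F$ together with a norm-bounded lattice homomorphism $\delta\colon\mathbb L\to F$ such that for every Banach lattice $X$ and every norm-bounded lattice homomorphism $T\colon\mathbb L\to X$ there is a unique Banach lattice homomorphism $\hat T\colon F\to X$ with $\hat T\circ\delta=T$, and moreover $\|\hat T\|=\|T\|$. Theorem. For every lattice $\mathbb L$ a free Banach lattice generated by $\mathbb L$ exists, and every free Banach lattice $FBL\langle\mathbb L\rangle$ generated by $\mathbb L$ is lattice isomorphic to an AM-space, and to a closed sublattice of $C(K)$ (with the supremum norm) for some compact Hausdorff space $K$. Here an AM-space is a Banach lattice $X$ such that $\|x\vee y\|=\max\{\|x\|,\|y\|\}$ for all positive $x,y\in X$ with $x\wedge y=0$, and a lattice isomorphism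 is a linear bijection, bounded together with its inverse, that preserves $\vee$ and $\wedge$ (it need not be isometric). -/

import Mathlib

universe u

/-- A real Banach lattice: a complete normed real vector lattice whose norm is solid
(`|x| ≤ |y|` implies `‖x‖ ≤ ‖y‖`). -/
class BanachLattice (E : Type*) [NormedAddCommGroup E] [NormedSpace ℝ E] [Lattice E] : Prop
    extends HasSolidNorm E, IsOrderedAddMonoid E, IsOrderedModule ℝ E, CompleteSpace E

/-- A bounded linear operator which is a lattice homomorphism, i.e. a homomorphism of Banach
lattices. -/
def IsBanachLatticeHom {E X : Type*} [NormedAddCommGroup E] [NormedSpace ℝ E] [Lattice E]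
    [NormedAddCommGroup X] [NormedSpace ℝ X] [Lattice X] (T : E →L[ℝ] X) : Prop :=
  ∀ x y : E, T (x ⊔ y) = T x ⊔ T y ∧ T (x ⊓ y) = T x ⊓ T y

/-- A lattice homomorphism from a lattice into a normed lattice is norm-bounded. -/
def IsNormBounded {L X : Type*} [Lattice L] [NormedAddCommGroup X] [Lattice X]
    (T : LatticeHom L X) : Prop :=
  BddAbove (Set.range fun x : L => ‖T x‖)

/-- The norm `sup {‖T x‖ : x ∈ L}` of a norm-bounded lattice homomorphism (`0` if `L` is empty). -/
noncomputable def supNorm {L X : Type*} [Lattice L] [NormedAddCommGroup X] [Lattice X]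
    (T : LatticeHom L X) : ℝ :=
  ⨆ x : L, ‖T x‖

/-- `F` together with `δ : L → F` is a free Banach lattice generated by the lattice `L`: `δ` is a
norm-bounded lattice homomorphism, and every norm-bounded lattice homomorphism `T` from `L` into a
Banach lattice `X` factors through `δ` by exactly one Banach lattice homomorphism, which moreover
has the same norm as `T`. -/
structure IsFreeBanachLattice {L F : Type u} [Lattice L] [NormedAddCommGroup F] [NormedSpace ℝ F]
    [Lattice F] [BanachLattice F] (δ : LatticeHom L F) : Prop where
  isNormBounded : IsNormBounded δ
  exists_unique_lift : ∀ (X : Type u) [NormedAddCommGroup X] [NormedSpace ℝ X] [Lattice X]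
    [BanachLattice X] (T : LatticeHom L X), IsNormBounded T →
      ∃ S : F →L[ℝ] X, IsBanachLatticeHom S ∧ (∀ x : L, S (δ x) = T x) ∧ ‖S‖ = supNorm T ∧
        ∀ S' : F →L[ℝ] X, IsBanachLatticeHom S' → (∀ x : L, S' (δ x) = T x) → S' = S

/-- A Banach lattice is an AM-space if `‖x ⊔ y‖ = max ‖x‖ ‖y‖` for positive disjoint `x`, `y`. -/
def IsAMSpace (X : Type*) [NormedAddCommGroup X] [NormedSpace ℝ X] [Lattice X]
    [BanachLattice X] : Prop :=
  ∀ x y : X, 0 ≤ x → 0 ≤ y → x ⊓ y = 0 → ‖x ⊔ y‖ = max ‖x‖ ‖y‖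

/-- `E` is lattice isomorphic to some AM-space (not necessarily isometrically). -/
def IsIsomorphicToAMSpace (E : Type u) [NormedAddCommGroup E] [NormedSpace ℝ E]
    [Lattice E] : Prop :=
  ∃ (X : Type u) (_ : NormedAddCommGroup X) (_ : NormedSpace ℝ X) (_ : Lattice X)
    (_ : BanachLattice X), IsAMSpace X ∧
      ∃ e : E ≃L[ℝ] X, IsBanachLatticeHom (e : E →L[ℝ] X)

/-- `E` is lattice isomorphic (not necessarily isometrically) to a closed sublattice `S` of the
Banach lattice `C(K, ℝ)`, with its supremum norm, for some compact Hausdorff space `K`. -/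
def IsIsomorphicToSublatticeOfCK (E : Type u) [NormedAddCommGroup E] [NormedSpace ℝ E]
    [Lattice E] : Prop :=
  ∃ (K : Type u) (_ : TopologicalSpace K) (_ : CompactSpace K) (_ : T2Space K)
    (S : Submodule ℝ C(K, ℝ)), IsClosed (S : Set C(K, ℝ)) ∧
      (∀ f ∈ S, ∀ g ∈ S, f ⊔ g ∈ S ∧ f ⊓ g ∈ S) ∧
      ∃ e : E ≃L[ℝ] S, ∀ x y : E,
        (e (x ⊔ y) : C(K, ℝ)) = (e x : C(K, ℝ)) ⊔ (e y : C(K, ℝ)) ∧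
        (e (x ⊓ y) : C(K, ℝ)) = (e x : C(K, ℝ)) ⊓ (e y : C(K, ℝ))

/-! Let `K` be the compact space of lattice homomorphisms `L → [-1, 1]`, and let `E` be the closed
vector sublattice of `C(K)` generated by the evaluations. Up to an equivalent norm, `E` is the free
Banach lattice.

The main estimate is as follows. Let `‖T x‖ ≤ C` for all `x`, and let `u` be built from values of
`T` by the same lattice-linear expression that builds `f` from evaluations; then `‖u‖ ≤ 2C‖f‖`. The
finitely many elements of `L` involved lie between some `m` and `M`. Truncating `T` between `T m`
and `T M` does not change its values at them, and puts all its values between `-e` and `e`, where `e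
= |T m| + |T M|`. Each real lattice homomorphism `φ` on the ideal of `e` with `φ e = 1` turns the
truncation into a point of `K`, at which `f` takes the value `φ u`. Such `φ` determine the order of
the ideal, so `|u| ≤ ‖f‖ e`, while `‖e‖ ≤ 2C`.

That there are enough `φ` is a Hahn–Banach argument: the gauge of an order unit is sublinear and
preserves suprema, and below such a functional the minimal ones given by Zorn's lemma are linear.

By the estimate, the closed sublattice generated by the pairs `(evalHom L x, T x)` is the graph of a
bounded lattice homomorphism on `E`. The factor 2 is removed by renorming `E` with the supremum of
the norms of the images under all extensions of contractive `T`; this lies between the supremum norm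
and twice it. The universal property then carries the representation over to every free Banach
lattice. -/

/-! ### Lattice homomorphisms below a sup-preserving sublinear functional -/

section SupSublinear

open Filter Topology

variable {V : Type*} [AddCommGroup V] [Module ℝ V] [Lattice V]

/-- A sublinear functional on a vector lattice which preserves binary suprema. -/
structure IsSupSublinear (p : V → ℝ) : Prop where
  add_le : ∀ x y, p (x + y) ≤ p x + p y
  smul : ∀ (r : ℝ) (x : V), 0 < r → p (r • x) = r * p x
  sup : ∀ x y, p (x ⊔ y) = p x ⊔ p y

namespace IsSupSublinear

variable {p : V → ℝ}

theorem map_zero (hp : IsSupSublinear p) : p 0 = 0 := by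
  have h := hp.smul 2 0 two_pos
  rw [smul_zero] at h
  linarith

theorem neg_le (hp : IsSupSublinear p) (x : V) : -p (-x) ≤ p x := by
  have h := hp.add_le x (-x)
  rw [add_neg_cancel, hp.map_zero] at h
  linarith

/-- Pointwise limits of sup-preserving sublinear functionals are sup-preserving and sublinear. -/
theorem of_tendsto {ι : Type*} {l : Filter ι} [l.NeBot] {f : ι → V → ℝ} {q : V → ℝ}
    (hf : ∀ i, IsSupSublinear (f i)) (h : ∀ x, Tendsto (fun i => f i x) l (𝓝 (q x))) :
    IsSupSublinear q where
  add_le x y := le_of_tendsto_of_tendsto' (h (x + y)) ((h x).add (h y)) fun i => (hf i).add_le x y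
  smul r x hr := tendsto_nhds_unique (h (r • x)) <| by
    simpa only [(hf _).smul r x hr] using (h x).const_mul r
  sup x y := tendsto_nhds_unique (h (x ⊔ y)) <| by
    simpa only [(hf _).sup x y] using (h x).sup_nhds (h y)

/-- Subadditivity for `x + s • y = (x + t • y) + (s - t) • y` with `t < s`. -/
theorem antitone_slope (hp : IsSupSublinear p) (x y : V) :
    Antitone fun t : ℝ => p (x + t • y) - t * p y := by
  intro t s hts
  rcases hts.eq_or_lt with rfl | hlt
  · exact le_rfl
  have h := hp.add_le (x + t • y) ((s - t) • y)
  rw [hp.smul _ _ (sub_pos.2 hlt)] at h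
  have e : x + t • y + (s - t) • y = x + s • y := by module
  rw [e] at h
  dsimp only
  linarith

theorem bddBelow_slope (hp : IsSupSublinear p) (x y : V) :
    BddBelow (Set.range fun t : ℝ => p (x + t • y) - t * p y) := by
  refine ⟨-p (-x), ?_⟩
  rintro _ ⟨t, rfl⟩
  -- Moving to `max t 1` only decreases the value and makes the coefficient positive, so homogeneity
  -- applies.
  refine le_trans ?_ (hp.antitone_slope x y (le_max_left t 1))
  have h := hp.add_le (x + max t 1 • y) (-x)
  have e : x + max t 1 • y + -x = max t 1 • y := by abel
  rw [e, hp.smul _ _ (by positivity)] at h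
  dsimp only
  linarith

/-- The one-sided derivative of `p` at infinity in the direction `y`. -/
noncomputable def slope (p : V → ℝ) (y x : V) : ℝ := ⨅ t : ℝ, (p (x + t • y) - t * p y)

theorem tendsto_slope (hp : IsSupSublinear p) (y x : V) :
    Tendsto (fun t : ℝ => p (x + t • y) - t * p y) atTop (𝓝 (slope p y x)) :=
  tendsto_atTop_ciInf (hp.antitone_slope x y) (hp.bddBelow_slope x y)

theorem slope_le (hp : IsSupSublinear p) (y x : V) (t : ℝ) :
    slope p y x ≤ p (x + t • y) - t * p y :=
  ciInf_le (hp.bddBelow_slope x y) t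

theorem slope_le_self (hp : IsSupSublinear p) (y : V) : slope p y ≤ p := fun x => by
  simpa using hp.slope_le y x 0

/-- The value at `t = 1`. This inequality is what makes a minimal functional odd. -/
theorem slope_neg_le (hp : IsSupSublinear p) (y : V) : slope p y (-y) ≤ -p y := by
  simpa [hp.map_zero] using hp.slope_le y (-y) 1

/-- Translation by `t • y` commutes with suprema, and limits along `t → ∞` preserve the rest. The
parameter is rescaled to `2 * t` for sums, where two translations add up, and to `r * t` for
multiples. -/
theorem isSupSublinear_slope [IsOrderedAddMonoid V] (hp : IsSupSublinear p) (y : V) :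
    IsSupSublinear (slope p y) where
  add_le u v := by
    have h2 : Tendsto (fun t : ℝ => 2 * t) atTop atTop :=
      tendsto_id.const_mul_atTop two_pos
    refine le_of_tendsto_of_tendsto' ((hp.tendsto_slope y (u + v)).comp h2)
      ((hp.tendsto_slope y u).add (hp.tendsto_slope y v)) fun t => ?_
    have h := hp.add_le (u + t • y) (v + t • y)
    have e : u + t • y + (v + t • y) = u + v + (2 * t) • y := by module
    rw [e] at h
    simp only [Function.comp_apply]
    linarith
  smul r x hr := by
    have h2 : Tendsto (fun t : ℝ => r * t) atTop atTop := tendsto_id.const_mul_atTop hr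
    refine tendsto_nhds_unique ((hp.tendsto_slope y (r • x)).comp h2) ?_
    refine ((hp.tendsto_slope y x).const_mul r).congr fun t => ?_
    have e : r • x + (r * t) • y = r • (x + t • y) := by module
    simp only [Function.comp_apply]
    rw [e, hp.smul _ _ hr]
    ring
  sup u v := by
    refine tendsto_nhds_unique (hp.tendsto_slope y (u ⊔ v)) ?_
    refine ((hp.tendsto_slope y u).sup_nhds (hp.tendsto_slope y v)).congr fun t => ?_
    rw [sup_add, hp.sup, ← max_sub_sub_right]

/-- Every sup-preserving sublinear functional dominates a linear lattice homomorphism. -/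
theorem exists_linear_le [IsOrderedAddMonoid V] (hp : IsSupSublinear p) :
    ∃ φ : V →ₗ[ℝ] ℝ, (∀ x, φ x ≤ p x) ∧ ∀ x y, φ (x ⊔ y) = φ x ⊔ φ y := by
  obtain ⟨m, hmp, hm⟩ := zorn_le_nonempty₀ (α := (V → ℝ)ᵒᵈ)
    {q | IsSupSublinear (OrderDual.ofDual q)} (fun c hc hchain q₀ hq₀ => by
      have : Nonempty c := ⟨⟨q₀, hq₀⟩⟩
      have : IsDirectedOrder c := ⟨fun a b => by
        rcases hchain.total a.2 b.2 with h | h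
        exacts [⟨b, h, le_rfl⟩, ⟨a, le_rfl, h⟩]⟩
      have hanti (x : V) : Antitone fun i : c => OrderDual.ofDual i.1 x := fun i j hij => hij x
      have hbdd (x : V) : BddBelow (Set.range fun i : c => OrderDual.ofDual i.1 x) := by
        -- A member `q ≤ q₀` of the chain satisfies `q x ≥ -q (-x) ≥ -q₀ (-x)`; one above `q₀` is at
        -- least `q₀ x`.
        refine ⟨-(OrderDual.ofDual q₀) (-x), ?_⟩
        rintro _ ⟨i, rfl⟩
        rcases hchain.total i.2 hq₀ with h | h
        · exact ((hc hq₀).neg_le x).trans (h x)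
        · exact le_trans (neg_le_neg (h (-x))) ((hc i.2).neg_le x)
      refine ⟨OrderDual.toDual fun x => ⨅ i : c, OrderDual.ofDual i.1 x, ?_, fun z hz x => ?_⟩
      · exact of_tendsto (l := atTop) (f := fun i : c => OrderDual.ofDual i.1)
          (fun i => hc i.2) fun x => tendsto_atTop_ciInf (hanti x) (hbdd x)
      · exact ciInf_le (hbdd x) ⟨z, hz⟩) (OrderDual.toDual p) hp
  set q : V → ℝ := OrderDual.ofDual m
  have hq : IsSupSublinear q := hm.prop
  have hneg (y : V) : q (-y) = -q y := by
    refine le_antisymm ?_ (_root_.neg_le.1 (by simpa using hq.neg_le y))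
    -- The slope is an admissible functional below `q`, so minimality gives equality, and its value
    -- at `-y` is at most `-q y`.
    have h : q ≤ slope q y := hm.le_of_ge (y := OrderDual.toDual (slope q y))
      (hq.isSupSublinear_slope y) (hq.slope_le_self y)
    exact (h (-y)).trans (hq.slope_neg_le y)
  have hadd (x y : V) : q (x + y) = q x + q y := by
    refine le_antisymm (hq.add_le x y) ?_
    have h := hq.add_le (x + y) (-y)
    rw [add_neg_cancel_right, hneg] at h
    linarith
  refine ⟨⟨⟨q, hadd⟩, fun r x => ?_⟩, hmp, hq.sup⟩
  simp only [RingHom.id_apply, smul_eq_mul]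
  rcases lt_trichotomy r 0 with h | rfl | h
  · have := hq.smul (-r) x (neg_pos.2 h)
    rw [neg_smul, hneg] at this
    linarith
  · simp [hq.map_zero]
  · exact hq.smul r x h

/-- A sup-preserving sublinear functional is the maximum of the linear lattice homomorphisms
below it. -/
theorem exists_linear_le_eq [IsOrderedAddMonoid V] (hp : IsSupSublinear p) (y : V) :
    ∃ φ : V →ₗ[ℝ] ℝ, (∀ x, φ x ≤ p x) ∧ (∀ x y, φ (x ⊔ y) = φ x ⊔ φ y) ∧ φ y = p y := by
  -- Below the slope in direction `y`, rather than below `p`, the bound `φ (-y) ≤ -p y` forces `φ y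
  -- = p y`.
  obtain ⟨φ, hφ, hsup⟩ := (hp.isSupSublinear_slope y).exists_linear_le
  refine ⟨φ, fun x => (hφ x).trans (hp.slope_le_self y x), hsup,
    le_antisymm ((hφ y).trans (hp.slope_le_self y y)) ?_⟩
  have h := (hφ (-y)).trans (hp.slope_neg_le y)
  rw [_root_.map_neg] at h
  linarith

end IsSupSublinear

/-! ### Order units -/

variable [IsOrderedAddMonoid V] [IsOrderedModule ℝ V]

/-- The gauge `x ↦ inf {r | x ≤ r e}` of an order unit `e`. -/
noncomputable def unitGauge (e x : V) : ℝ := sInf {r : ℝ | x ≤ r • e}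

variable {e : V}

theorem unit_nonneg_of_ne (he : 0 ≤ e) (hne : e ≠ 0) {r : ℝ} (h : 0 ≤ r • e) : 0 ≤ r := by
  by_contra! hr
  refine hne (le_antisymm ?_ he)
  have := smul_le_smul_of_nonneg_left h (inv_nonneg.2 (neg_nonneg.2 hr.le))
  rw [smul_zero, smul_smul, inv_neg, neg_mul, inv_mul_cancel₀ hr.ne, neg_one_smul] at this
  exact neg_nonneg.1 this

theorem bddBelow_unitGauge (he : 0 ≤ e) (hne : e ≠ 0) {x : V} {s : ℝ} (hs : -x ≤ s • e) :
    -s ∈ lowerBounds {r : ℝ | x ≤ r • e} := fun r hr => by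
  have h : 0 ≤ (r + s) • e := by
    rw [add_smul]
    simpa using add_le_add (show x ≤ r • e from hr) hs
  linarith [unit_nonneg_of_ne he hne h]

theorem le_smul_of_unitGauge_lt (he : 0 ≤ e) (hunit : ∀ x : V, ∃ r : ℝ, x ≤ r • e) {x : V}
    {r : ℝ} (h : unitGauge e x < r) : x ≤ r • e := by
  obtain ⟨s, hs, hsr⟩ := exists_lt_of_csInf_lt (hunit x) h
  exact le_trans hs (smul_le_smul_of_nonneg_right hsr.le he)

theorem unitGauge_le (he : 0 ≤ e) (hne : e ≠ 0) (hunit : ∀ x : V, ∃ r : ℝ, x ≤ r • e) {x : V}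
    {r : ℝ} (h : x ≤ r • e) : unitGauge e x ≤ r :=
  csInf_le ((hunit (-x)).elim fun _ hs => ⟨_, bddBelow_unitGauge he hne hs⟩) h

theorem isSupSublinear_unitGauge (he : 0 ≤ e) (hne : e ≠ 0)
    (hunit : ∀ x : V, ∃ r : ℝ, x ≤ r • e) : IsSupSublinear (unitGauge e) := by
  have hmono {x y : V} (h : x ≤ y) : unitGauge e x ≤ unitGauge e y :=
    le_of_forall_gt_imp_ge_of_dense fun r hr =>
      unitGauge_le he hne hunit (h.trans (le_smul_of_unitGauge_lt he hunit hr))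
  have hsmul (r : ℝ) (x : V) (hr : 0 < r) : unitGauge e (r • x) ≤ r * unitGauge e x := by
    refine le_of_forall_gt_imp_ge_of_dense fun s hs => unitGauge_le he hne hunit ?_
    have h : unitGauge e x < r⁻¹ * s := by rwa [lt_inv_mul_iff₀ hr]
    have := smul_le_smul_of_nonneg_left (le_smul_of_unitGauge_lt he hunit h) hr.le
    rwa [smul_smul, mul_inv_cancel_left₀ hr.ne'] at this
  refine ⟨fun x y => ?_, fun r x hr => le_antisymm (hsmul r x hr) ?_, fun x y => ?_⟩
  · refine le_of_forall_pos_le_add fun ε hε => unitGauge_le he hne hunit ?_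
    have h1 := le_smul_of_unitGauge_lt (x := x) he hunit (lt_add_of_pos_right _ (half_pos hε))
    have h2 := le_smul_of_unitGauge_lt (x := y) he hunit (lt_add_of_pos_right _ (half_pos hε))
    refine (add_le_add h1 h2).trans_eq ?_
    rw [← add_smul]
    congr 1
    ring
  · have := hsmul r⁻¹ (r • x) (inv_pos.2 hr)
    rwa [smul_smul, inv_mul_cancel₀ hr.ne', one_smul, le_inv_mul_iff₀ hr] at this
  · refine le_antisymm (le_of_forall_gt_imp_ge_of_dense fun r hr => ?_)
      (sup_le (hmono le_sup_left) (hmono le_sup_right))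
    exact unitGauge_le he hne hunit (sup_le
      (le_smul_of_unitGauge_lt he hunit (lt_of_le_of_lt le_sup_left hr))
      (le_smul_of_unitGauge_lt he hunit (lt_of_le_of_lt le_sup_right hr)))

/-- If every real lattice homomorphism normalized at the order unit `e` is at most `c` at `y`, then
`y ≤ r e` for all `r > c`. -/
theorem le_smul_of_forall_latticeHom_le (he : 0 ≤ e) (hunit : ∀ x : V, ∃ r : ℝ, x ≤ r • e)
    {y : V} {c : ℝ}
    (h : ∀ φ : V →ₗ[ℝ] ℝ, (∀ x y, φ (x ⊔ y) = φ x ⊔ φ y) → φ e = 1 → φ y ≤ c) {r : ℝ}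
    (hr : c < r) : y ≤ r • e := by
  rcases eq_or_ne e 0 with rfl | hne
  -- If `e = 0`, the order unit condition already says `y ≤ 0`.
  · obtain ⟨s, hs⟩ := hunit y
    simpa using hs
  obtain ⟨φ, hle, hsup, hφ⟩ := (isSupSublinear_unitGauge he hne hunit).exists_linear_le_eq y
  refine le_smul_of_unitGauge_lt he hunit (lt_of_le_of_lt (hφ ▸ h φ hsup (le_antisymm ?_ ?_)) hr)
  · exact (hle e).trans (unitGauge_le he hne hunit (one_smul ℝ e).ge)
  · have := (hle (-e)).trans (unitGauge_le he hne hunit (r := -1) (by simp))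
    rw [map_neg] at this
    linarith

end SupSublinear

/-! ### Vector sublattices -/

/-- A linear subspace of a vector lattice which is closed under binary suprema and infima. -/
structure VectorSublattice (E : Type*) [AddCommGroup E] [Module ℝ E] [Lattice E] extends
    Submodule ℝ E where
  sup_mem : ∀ {x y : E}, x ∈ carrier → y ∈ carrier → x ⊔ y ∈ carrier
  inf_mem : ∀ {x y : E}, x ∈ carrier → y ∈ carrier → x ⊓ y ∈ carrier

namespace VectorSublattice

section Algebra

variable {E E' : Type*} [AddCommGroup E] [Module ℝ E] [Lattice E]
  [AddCommGroup E'] [Module ℝ E'] [Lattice E']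

instance (W : VectorSublattice E) : Lattice W.toSubmodule :=
  Subtype.lattice (fun _ _ => W.sup_mem) (fun _ _ => W.inf_mem)

theorem coe_le (W : VectorSublattice E) {x y : W.toSubmodule} : x ≤ y ↔ (x : E) ≤ y := Iff.rfl

instance (W : VectorSublattice E) [IsOrderedAddMonoid E] : IsOrderedAddMonoid W.toSubmodule where
  add_le_add_left _ _ h c := W.coe_le.2 (add_le_add_left (W.coe_le.1 h) (c : E))

instance (W : VectorSublattice E) [IsOrderedModule ℝ E] : IsOrderedModule ℝ W.toSubmodule where
  smul_le_smul_of_nonneg_left _ hr _ _ h :=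
    W.coe_le.2 (smul_le_smul_of_nonneg_left (W.coe_le.1 h) hr)
  smul_le_smul_of_nonneg_right x hx _ _ h :=
    W.coe_le.2 (smul_le_smul_of_nonneg_right (b := (x : E)) h (W.coe_le.1 hx))

/-- The preimage of a vector sublattice under a linear lattice homomorphism. -/
def comap (f : E →ₗ[ℝ] E') (hf : ∀ x y, f (x ⊔ y) = f x ⊔ f y ∧ f (x ⊓ y) = f x ⊓ f y)
    (W : VectorSublattice E') : VectorSublattice E where
  toSubmodule := W.toSubmodule.comap f
  sup_mem {x y} hx hy := show f (x ⊔ y) ∈ W.carrier from (hf x y).1 ▸ W.sup_mem hx hy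
  inf_mem {x y} hx hy := show f (x ⊓ y) ∈ W.carrier from (hf x y).2 ▸ W.inf_mem hx hy

/-- The image of a vector sublattice under a linear lattice homomorphism. -/
def map (f : E →ₗ[ℝ] E') (hf : ∀ x y, f (x ⊔ y) = f x ⊔ f y ∧ f (x ⊓ y) = f x ⊓ f y)
    (W : VectorSublattice E) : VectorSublattice E' where
  toSubmodule := W.toSubmodule.map f
  sup_mem := by
    rintro _ _ ⟨x, hx, rfl⟩ ⟨y, hy, rfl⟩
    exact ⟨x ⊔ y, W.sup_mem hx hy, (hf x y).1⟩
  inf_mem := by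
    rintro _ _ ⟨x, hx, rfl⟩ ⟨y, hy, rfl⟩
    exact ⟨x ⊓ y, W.inf_mem hx hy, (hf x y).2⟩

/-- The vector sublattice generated by a set. -/
def gen (s : Set E) : VectorSublattice E where
  carrier := {x | ∀ W : VectorSublattice E, s ⊆ W.carrier → x ∈ W.carrier}
  zero_mem' W _ := W.zero_mem
  add_mem' hx hy W hW := W.add_mem (hx W hW) (hy W hW)
  smul_mem' r _ hx W hW := W.smul_mem r (hx W hW)
  sup_mem hx hy W hW := W.sup_mem (hx W hW) (hy W hW)
  inf_mem hx hy W hW := W.inf_mem (hx W hW) (hy W hW)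

theorem subset_gen (s : Set E) : s ⊆ (gen s).carrier := fun _ hx _ hW => hW hx

end Algebra

section Topology

variable {E : Type*} [AddCommGroup E] [Module ℝ E] [Lattice E] [TopologicalSpace E]
  [IsTopologicalAddGroup E] [ContinuousConstSMul ℝ E] [ContinuousSup E] [ContinuousInf E]

/-- The closure of a vector sublattice. -/
def closure (W : VectorSublattice E) : VectorSublattice E where
  toSubmodule := W.toSubmodule.topologicalClosure
  sup_mem hx hy := map_mem_closure₂ continuous_sup hx hy fun _ hx _ hy => W.sup_mem hx hy
  inf_mem hx hy := map_mem_closure₂ continuous_inf hx hy fun _ hx _ hy => W.inf_mem hx hy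

/-- The closed vector sublattice generated by a set. -/
def closedGen (s : Set E) : VectorSublattice E := (gen s).closure

theorem isClosed_closedGen (s : Set E) : IsClosed (closedGen s).carrier := isClosed_closure

theorem subset_closedGen (s : Set E) : s ⊆ (closedGen s).carrier :=
  (subset_gen s).trans subset_closure

theorem closedGen_subset {s : Set E} {W : VectorSublattice E} (hs : s ⊆ W.carrier)
    (hW : IsClosed W.carrier) : (closedGen s).carrier ⊆ W.carrier :=
  closure_minimal (fun _ hx => hx W hs) hW

end Topology

theorem banachLattice {E : Type*} [NormedAddCommGroup E] [NormedSpace ℝ E] [Lattice E]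
    [BanachLattice E] (W : VectorSublattice E) (hW : IsClosed W.carrier) :
    BanachLattice W.toSubmodule where
  solid _ _ h := HasSolidNorm.solid (α := E) (W.coe_le.1 h)
  toCompleteSpace := IsClosed.completeSpace_coe (s := W.carrier) (hs := hW)

end VectorSublattice

/-! ### Continuous functions and products -/

instance (K : Type*) [TopologicalSpace K] [CompactSpace K] : HasSolidNorm C(K, ℝ) where
  solid {f g} h := (ContinuousMap.norm_le f (norm_nonneg g)).2 fun k => by
    have hk : |f k| ≤ |g k| := h k
    exact hk.trans (g.norm_coe_le_norm k)

instance (K : Type*) [TopologicalSpace K] [CompactSpace K] : BanachLattice C(K, ℝ) where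

theorem norm_sup_eq_max {K : Type*} [TopologicalSpace K] [CompactSpace K] {f g : C(K, ℝ)}
    (hf : 0 ≤ f) (hg : 0 ≤ g) : ‖f ⊔ g‖ = max ‖f‖ ‖g‖ := by
  refine le_antisymm ((ContinuousMap.norm_le _ (by positivity)).2 fun k => ?_) (max_le ?_ ?_)
  · have h1 := (le_abs_self _).trans (f.norm_coe_le_norm k)
    have h2 := (le_abs_self _).trans (g.norm_coe_le_norm k)
    have h0 : 0 ≤ f k := hf k
    rw [Real.norm_eq_abs, ContinuousMap.sup_apply, abs_of_nonneg (h0.trans le_sup_left)]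
    exact max_le_max h1 h2
  · exact norm_le_norm_of_abs_le_abs (abs_le_abs_of_nonneg hf le_sup_left)
  · exact norm_le_norm_of_abs_le_abs (abs_le_abs_of_nonneg hg le_sup_right)

/-- Needed to take closures of vector sublattices of `C(K) × X`, where graphs of extensions live. -/
instance {E F : Type*} [TopologicalSpace E] [TopologicalSpace F] [Max E] [Max F]
    [ContinuousSup E] [ContinuousSup F] : ContinuousSup (E × F) where
  continuous_sup := by
    have h1 : Continuous fun p : (E × F) × (E × F) => p.1.1 ⊔ p.2.1 :=
      continuous_sup.comp (f := fun p : (E × F) × (E × F) => (p.1.1, p.2.1)) (by fun_prop)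
    have h2 : Continuous fun p : (E × F) × (E × F) => p.1.2 ⊔ p.2.2 :=
      continuous_sup.comp (f := fun p : (E × F) × (E × F) => (p.1.2, p.2.2)) (by fun_prop)
    exact h1.prodMk h2

instance {E F : Type*} [TopologicalSpace E] [TopologicalSpace F] [Min E] [Min F]
    [ContinuousInf E] [ContinuousInf F] : ContinuousInf (E × F) where
  continuous_inf := by
    have h1 : Continuous fun p : (E × F) × (E × F) => p.1.1 ⊓ p.2.1 :=
      continuous_inf.comp (f := fun p : (E × F) × (E × F) => (p.1.1, p.2.1)) (by fun_prop)
    have h2 : Continuous fun p : (E × F) × (E × F) => p.1.2 ⊓ p.2.2 :=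
      continuous_inf.comp (f := fun p : (E × F) × (E × F) => (p.1.2, p.2.2)) (by fun_prop)
    exact h1.prodMk h2

/-! ### Principal ideals -/

section PrincipalIdeal

variable {X : Type*} [AddCommGroup X] [Module ℝ X] [Lattice X] [IsOrderedAddMonoid X]
  [IsOrderedModule ℝ X]

/-- The ideal of all `x` with `-r e ≤ x ≤ r e` for some `r`. -/
def principalIdeal (e : X) (he : 0 ≤ e) : VectorSublattice X where
  carrier := {x | ∃ r : ℝ, 0 ≤ r ∧ -(r • e) ≤ x ∧ x ≤ r • e}
  zero_mem' := ⟨0, le_rfl, by simp, by simp⟩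
  add_mem' := by
    rintro x y ⟨r, hr, h1, h2⟩ ⟨s, hs, h3, h4⟩
    refine ⟨r + s, add_nonneg hr hs, ?_, ?_⟩
    · rw [add_smul, neg_add]
      exact add_le_add h1 h3
    · rw [add_smul]
      exact add_le_add h2 h4
  smul_mem' c x := by
    rintro ⟨r, hr, h1, h2⟩
    rcases le_total 0 c with hc | hc
    · refine ⟨c * r, mul_nonneg hc hr, ?_, ?_⟩
      · rw [mul_smul, ← smul_neg]
        exact smul_le_smul_of_nonneg_left h1 hc
      · rw [mul_smul]
        exact smul_le_smul_of_nonneg_left h2 hc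
    · refine ⟨-c * r, mul_nonneg (neg_nonneg.2 hc) hr, ?_, ?_⟩
      · have := smul_le_smul_of_nonneg_left (neg_le_neg h2) (neg_nonneg.2 hc)
        simpa [mul_smul] using this
      · have := smul_le_smul_of_nonneg_left (neg_le_neg h1) (neg_nonneg.2 hc)
        simpa [mul_smul] using this
  sup_mem := by
    rintro x y ⟨r, hr, h1, h2⟩ ⟨s, hs, h3, h4⟩
    refine ⟨max r s, hr.trans (le_max_left _ _), le_trans ?_ (h1.trans le_sup_left),
      sup_le (h2.trans ?_) (h4.trans ?_)⟩
    · exact neg_le_neg (smul_le_smul_of_nonneg_right (le_max_left _ _) he)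
    · exact smul_le_smul_of_nonneg_right (le_max_left _ _) he
    · exact smul_le_smul_of_nonneg_right (le_max_right _ _) he
  inf_mem := by
    rintro x y ⟨r, hr, h1, h2⟩ ⟨s, hs, h3, h4⟩
    refine ⟨max r s, hr.trans (le_max_left _ _), le_inf (le_trans ?_ h1) (le_trans ?_ h3),
      inf_le_left.trans (h2.trans ?_)⟩
    · exact neg_le_neg (smul_le_smul_of_nonneg_right (le_max_left _ _) he)
    · exact neg_le_neg (smul_le_smul_of_nonneg_right (le_max_right _ _) he)
    · exact smul_le_smul_of_nonneg_right (le_max_left _ _) he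

theorem mem_principalIdeal_of_le {e : X} (he : 0 ≤ e) {x : X} (h1 : -e ≤ x) (h2 : x ≤ e) :
    x ∈ (principalIdeal e he).toSubmodule :=
  ⟨1, zero_le_one, by simpa using h1, by simpa using h2⟩

end PrincipalIdeal

open Filter Topology in
/-- If all real lattice homomorphisms on the principal ideal of `e` which are normalized at `e`
are bounded by `c` at `±y`, then `|y| ≤ c e`. -/
theorem abs_le_smul_of_forall_latticeHom_le {X : Type*} [NormedAddCommGroup X] [NormedSpace ℝ X]
    [Lattice X] [BanachLattice X] {e : X} (he : 0 ≤ e) (y : (principalIdeal e he).toSubmodule)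
    {c : ℝ}
    (h : ∀ φ : (principalIdeal e he).toSubmodule →ₗ[ℝ] ℝ, (∀ x y, φ (x ⊔ y) = φ x ⊔ φ y) →
      (∀ h, φ ⟨e, h⟩ = 1) → |φ y| ≤ c) : |(y : X)| ≤ c • e := by
  have hmem : e ∈ (principalIdeal e he).toSubmodule :=
    mem_principalIdeal_of_le he ((neg_nonpos.2 he).trans he) le_rfl
  have key (z : (principalIdeal e he).toSubmodule) (hz : ∀ φ : (principalIdeal e he).toSubmodule →ₗ[ℝ] ℝ, (∀ x y, φ (x ⊔ y) = φ x ⊔ φ y) →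
      φ ⟨e, hmem⟩ = 1 → φ z ≤ c) : (z : X) ≤ c • e := by
    have hr (r : ℝ) (hr : c < r) : (z : X) ≤ r • e :=
      le_smul_of_forall_latticeHom_le (e := (⟨e, hmem⟩ : (principalIdeal e he).toSubmodule)) he
        (fun x => x.2.imp fun r hr => hr.2.2) hz hr
    -- The order unit argument gives only `r > c`; the order of a Banach lattice is closed, so `r`
    -- may decrease to `c`.
    have hlim : Tendsto (fun r : ℝ => r • e) (𝓝[>] c) (𝓝 (c • e)) :=
      (tendsto_id.smul_const e).mono_left nhdsWithin_le_nhds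
    exact ge_of_tendsto hlim (eventually_nhdsWithin_of_forall fun r h => hr r h)
  refine sup_le (key y fun φ h1 h2 => (le_abs_self _).trans (h φ h1 fun _ => h2)) ?_
  exact key (-y) fun φ h1 h2 => by
    rw [map_neg]
    exact (neg_le_abs _).trans (h φ h1 fun _ => h2)

/-! ### The space of `[-1, 1]`-valued lattice homomorphisms -/

/-- The set of lattice homomorphisms from `L` to `[-1, 1]`. -/
def unitDualSet (L : Type*) [Lattice L] : Set (L → ℝ) :=
  {a | (∀ x, |a x| ≤ 1) ∧ ∀ x y, a (x ⊔ y) = a x ⊔ a y ∧ a (x ⊓ y) = a x ⊓ a y}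

theorem isCompact_unitDualSet (L : Type*) [Lattice L] : IsCompact (unitDualSet L) := by
  refine IsCompact.of_isClosed_subset (isCompact_univ_pi fun _ : L => isCompact_Icc)
    (s := Set.univ.pi fun _ => Set.Icc (-1) 1) ?_ fun a ha x _ => abs_le.1 (ha.1 x)
  simp only [unitDualSet, Set.ofPred_and, Set.ofPred_forall]
  refine (isClosed_iInter fun x => isClosed_le (by fun_prop) (by fun_prop)).inter
    (isClosed_iInter fun x => isClosed_iInter fun y =>
      (isClosed_eq (by fun_prop) ?_).inter (isClosed_eq (by fun_prop) ?_))
  · exact (continuous_apply x).sup (continuous_apply y)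
  · exact (continuous_apply x).inf (continuous_apply y)

/-- The compact space of lattice homomorphisms from `L` to `[-1, 1]`. -/
abbrev UnitDual (L : Type*) [Lattice L] : Type _ := unitDualSet L

instance (L : Type*) [Lattice L] : CompactSpace (UnitDual L) :=
  isCompact_iff_compactSpace.1 (isCompact_unitDualSet L)

/-- The evaluation map from `L` to the continuous functions on its unit dual. -/
def evalHom (L : Type*) [Lattice L] : LatticeHom L C(UnitDual L, ℝ) where
  toFun x := ⟨fun a => a.1 x, (continuous_apply x).comp continuous_subtype_val⟩
  map_sup' x y := by
    ext a
    exact (a.2.2 x y).1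
  map_inf' x y := by
    ext a
    exact (a.2.2 x y).2

theorem norm_evalHom_le {L : Type*} [Lattice L] (x : L) : ‖evalHom L x‖ ≤ 1 :=
  (ContinuousMap.norm_le _ zero_le_one).2 fun a => a.2.1 x

/-! ### Truncated homomorphisms and the main norm estimate -/

section Truncation

variable {L X : Type*} [Lattice L] [NormedAddCommGroup X] [NormedSpace ℝ X] [Lattice X]
  [BanachLattice X]

/-- The truncation of a lattice homomorphism to the values between those at `m` and `M`. -/
def truncation (T : LatticeHom L X) (m M : L) : LatticeHom L X where
  toFun x := (T x ⊓ T M) ⊔ T m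
  map_sup' x y := by
    -- A vector lattice is distributive whereas `L` need not be, which is why values in `X` are
    -- truncated and not elements of `L`.
    let _ : DistribLattice X := AddCommGroup.toDistribLattice X
    change (T (x ⊔ y) ⊓ T M) ⊔ T m = _
    rw [map_sup]
    rw [inf_sup_right, sup_sup_distrib_right]
  map_inf' x y := by
    let _ : DistribLattice X := AddCommGroup.toDistribLattice X
    rw [map_inf, inf_inf_distrib_right, sup_inf_right]

theorem truncation_apply (T : LatticeHom L X) (m M x : L) :
    truncation T m M x = (T x ⊓ T M) ⊔ T m := rfl

theorem truncation_eq_of_mem (T : LatticeHom L X) {m M x : L} (h1 : m ≤ x) (h2 : x ≤ M) :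
    truncation T m M x = T x := by
  rw [truncation_apply, inf_eq_left.2 (OrderHomClass.mono T h2),
    sup_eq_left.2 (OrderHomClass.mono T h1)]

/-- An upper bound for the absolute values of the truncated lattice homomorphism. -/
def truncationBound (T : LatticeHom L X) (m M : L) : X := |T m| + |T M|

theorem truncationBound_nonneg (T : LatticeHom L X) (m M : L) : 0 ≤ truncationBound T m M :=
  add_nonneg (abs_nonneg _) (abs_nonneg _)

theorem norm_truncationBound_le (T : LatticeHom L X) (m M : L) {C : ℝ} (hC : ∀ x, ‖T x‖ ≤ C) :
    ‖truncationBound T m M‖ ≤ 2 * C := by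
  refine (norm_add_le _ _).trans ?_
  rw [norm_abs_eq_norm, norm_abs_eq_norm, two_mul]
  exact add_le_add (hC m) (hC M)

theorem abs_truncation_le (T : LatticeHom L X) (m M x : L) :
    -truncationBound T m M ≤ truncation T m M x ∧
      truncation T m M x ≤ truncationBound T m M := by
  have h1 : |T m| ≤ truncationBound T m M := le_add_of_nonneg_right (abs_nonneg _)
  have h2 : |T M| ≤ truncationBound T m M := le_add_of_nonneg_left (abs_nonneg _)
  exact ⟨(neg_le.1 ((neg_le_abs _).trans h1)).trans le_sup_right,
    sup_le (inf_le_right.trans ((le_abs_self _).trans h2)) ((le_abs_self _).trans h1)⟩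

theorem truncation_mem (T : LatticeHom L X) (m M x : L) : truncation T m M x ∈
    (principalIdeal (truncationBound T m M) (truncationBound_nonneg T m M)).toSubmodule :=
  mem_principalIdeal_of_le _ (abs_truncation_le T m M x).1 (abs_truncation_le T m M x).2

theorem map_inf_of_map_sup {V : Type*} [AddCommGroup V] [Module ℝ V] [Lattice V]
    [IsOrderedAddMonoid V] {φ : V →ₗ[ℝ] ℝ} (h : ∀ x y, φ (x ⊔ y) = φ x ⊔ φ y) (x y : V) :
    φ (x ⊓ y) = φ x ⊓ φ y := by
  have h1 := h (-x) (-y)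
  rw [← neg_inf, map_neg, map_neg, map_neg, ← neg_inf, neg_inj] at h1
  exact h1

/-- A normalized lattice homomorphism on the principal ideal which contains the truncation of `T`
gives an element of the unit dual. -/
def truncationDual (T : LatticeHom L X) (m M : L)
    (φ : (principalIdeal (truncationBound T m M) (truncationBound_nonneg T m M)).toSubmodule
      →ₗ[ℝ] ℝ)
    (hsup : ∀ x y, φ (x ⊔ y) = φ x ⊔ φ y) (hφ : ∀ h, φ ⟨truncationBound T m M, h⟩ = 1) :
    UnitDual L where
  val x := φ ⟨truncation T m M x, truncation_mem T m M x⟩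
  property := by
    refine ⟨fun x => ?_, fun x y => ⟨?_, ?_⟩⟩
    · have hmono {u v} (h : u ≤ v) : φ u ≤ φ v := by
        have := hsup u v
        rw [sup_eq_right.2 h] at this
        exact this ▸ le_sup_left
      have hmem := mem_principalIdeal_of_le (truncationBound_nonneg T m M)
        ((neg_nonpos.2 (truncationBound_nonneg T m M)).trans (truncationBound_nonneg T m M)) le_rfl
      rw [abs_le, ← hφ hmem, ← map_neg]
      exact ⟨hmono (abs_truncation_le T m M x).1, hmono (abs_truncation_le T m M x).2⟩
    · rw [← hsup]
      exact congrArg φ (Subtype.ext (map_sup (truncation T m M) x y))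
    · rw [← map_inf_of_map_sup hsup]
      exact congrArg φ (Subtype.ext (map_inf (truncation T m M) x y))

/-- Pairs `(f, u)` such that `u` is obtained from the values of `T` in the same way as `f` from
the evaluations, as seen by lattice homomorphisms on the principal ideals of all sufficiently wide
truncations. -/
def compatiblePairs [Nonempty L] (T : LatticeHom L X) :
    VectorSublattice (C(UnitDual L, ℝ) × X) where
  carrier := {z | ∃ m₀ M₀ : L, ∀ m M, m ≤ m₀ → M₀ ≤ M →
    ∃ h : z.2 ∈ (principalIdeal (truncationBound T m M) (truncationBound_nonneg T m M)).toSubmodule,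
      ∀ φ hsup hφ, φ ⟨z.2, h⟩ = z.1 (truncationDual T m M φ hsup hφ)}
  zero_mem' := by
    inhabit L
    exact ⟨default, default, fun m M _ _ => ⟨Submodule.zero_mem _, fun φ _ _ => map_zero φ⟩⟩
  add_mem' := by
    rintro x y ⟨m, M, h⟩ ⟨m', M', h'⟩
    -- Since the condition holds for all wider truncations, two pairs can be compared at common
    -- bounds.
    refine ⟨m ⊓ m', M ⊔ M', fun n N hn hN => ?_⟩
    obtain ⟨h1, h2⟩ := h n N (hn.trans inf_le_left) (le_sup_left.trans hN)
    obtain ⟨h3, h4⟩ := h' n N (hn.trans inf_le_right) (le_sup_right.trans hN)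
    refine ⟨Submodule.add_mem _ h1 h3, fun φ hsup hφ => ?_⟩
    exact (map_add φ ⟨x.2, h1⟩ ⟨y.2, h3⟩).trans
      (congrArg₂ (· + ·) (h2 φ hsup hφ) (h4 φ hsup hφ))
  smul_mem' := by
    rintro r x ⟨m, M, h⟩
    refine ⟨m, M, fun n N hn hN => ?_⟩
    obtain ⟨h1, h2⟩ := h n N hn hN
    refine ⟨Submodule.smul_mem _ r h1, fun φ hsup hφ => ?_⟩
    exact (map_smul φ r ⟨x.2, h1⟩).trans (congrArg (r • ·) (h2 φ hsup hφ))
  sup_mem := by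
    rintro x y ⟨m, M, h⟩ ⟨m', M', h'⟩
    refine ⟨m ⊓ m', M ⊔ M', fun n N hn hN => ?_⟩
    obtain ⟨h1, h2⟩ := h n N (hn.trans inf_le_left) (le_sup_left.trans hN)
    obtain ⟨h3, h4⟩ := h' n N (hn.trans inf_le_right) (le_sup_right.trans hN)
    refine ⟨VectorSublattice.sup_mem _ h1 h3, fun φ hsup hφ => ?_⟩
    exact (hsup ⟨x.2, h1⟩ ⟨y.2, h3⟩).trans
      (congrArg₂ (· ⊔ ·) (h2 φ hsup hφ) (h4 φ hsup hφ))
  inf_mem := by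
    rintro x y ⟨m, M, h⟩ ⟨m', M', h'⟩
    refine ⟨m ⊓ m', M ⊔ M', fun n N hn hN => ?_⟩
    obtain ⟨h1, h2⟩ := h n N (hn.trans inf_le_left) (le_sup_left.trans hN)
    obtain ⟨h3, h4⟩ := h' n N (hn.trans inf_le_right) (le_sup_right.trans hN)
    refine ⟨VectorSublattice.inf_mem _ h1 h3, fun φ hsup hφ => ?_⟩
    exact (map_inf_of_map_sup hsup ⟨x.2, h1⟩ ⟨y.2, h3⟩).trans
      (congrArg₂ (· ⊓ ·) (h2 φ hsup hφ) (h4 φ hsup hφ))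

theorem graph_mem_compatiblePairs [Nonempty L] (T : LatticeHom L X) (x : L) :
    (evalHom L x, T x) ∈ (compatiblePairs T).carrier := by
  refine ⟨x, x, fun m M hm hM => ⟨?_, fun φ hsup hφ => ?_⟩⟩
  · have := truncation_mem T m M x
    rwa [truncation_eq_of_mem T hm hM] at this
  · change _ = φ ⟨truncation T m M x, _⟩
    congr 2
    exact (truncation_eq_of_mem T hm hM).symm

/-- A single truncation suffices: normalized functionals see `z.2` as values of `z.1`, so `|z.2|` is
at most `‖z.1‖` times a bound of norm at most `2 * C`. -/
theorem norm_snd_le_of_mem_compatiblePairs [Nonempty L] {T : LatticeHom L X} {C : ℝ}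
    (hC : ∀ x, ‖T x‖ ≤ C) {z : C(UnitDual L, ℝ) × X} (hz : z ∈ (compatiblePairs T).carrier) :
    ‖z.2‖ ≤ 2 * C * ‖z.1‖ := by
  obtain ⟨m, M, h⟩ := hz
  obtain ⟨h1, h2⟩ := h m M le_rfl le_rfl
  have key : |z.2| ≤ ‖z.1‖ • truncationBound T m M :=
    abs_le_smul_of_forall_latticeHom_le _ ⟨z.2, h1⟩ fun φ hsup hφ => by
      rw [h2 φ hsup hφ]
      exact z.1.norm_coe_le_norm _
  have h3 : ‖z.2‖ ≤ ‖‖z.1‖ • truncationBound T m M‖ :=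
    norm_le_norm_of_abs_le_abs (key.trans (le_abs_self _))
  rw [norm_smul, norm_norm, mul_comm] at h3
  exact h3.trans (mul_le_mul_of_nonneg_right (norm_truncationBound_le T m M hC) (norm_nonneg _))

/-! ### The graph of the extension of a lattice homomorphism -/

/-- The closed vector sublattice generated by the pairs of an evaluation and the corresponding
value of `T`. -/
noncomputable def liftGraph (T : LatticeHom L X) : VectorSublattice (C(UnitDual L, ℝ) × X) :=
  VectorSublattice.closedGen (Set.range fun x => (evalHom L x, T x))

/-- The truncation bounds depend on the pair, so it is the inequality, a closed condition, that
passes to the closure. -/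
theorem norm_snd_le_of_mem_liftGraph {T : LatticeHom L X} {C : ℝ}
    (hC : ∀ x, ‖T x‖ ≤ C) {z : C(UnitDual L, ℝ) × X} (hz : z ∈ (liftGraph T).carrier) :
    ‖z.2‖ ≤ 2 * C * ‖z.1‖ := by
  have hcl : IsClosed {z : C(UnitDual L, ℝ) × X | ‖z.2‖ ≤ 2 * C * ‖z.1‖} :=
    isClosed_le (by fun_prop) (by fun_prop)
  refine closure_minimal (fun z hz => ?_) hcl hz
  -- Truncation needs elements of `L`; for empty `L` the generated sublattice is zero.
  rcases isEmpty_or_nonempty L with hL | hL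
  · have h0 : z = 0 := hz ⟨⊥, by simp +contextual, by simp +contextual⟩ (by
      rintro _ ⟨x, -⟩
      exact isEmptyElim x)
    simp [h0]
  · exact norm_snd_le_of_mem_compatiblePairs hC
      (hz _ (Set.range_subset_iff.2 (graph_mem_compatiblePairs T)))

end Truncation

/-! ### Extension of lattice homomorphisms -/

/-- The closed vector sublattice of continuous functions generated by the evaluations. -/
noncomputable def evalSublattice (L : Type*) [Lattice L] : VectorSublattice C(UnitDual L, ℝ) :=
  VectorSublattice.closedGen (Set.range (evalHom L))

section Lift

variable {L X Y : Type*} [Lattice L] [NormedAddCommGroup X] [NormedSpace ℝ X] [Lattice X]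
  [BanachLattice X] [NormedAddCommGroup Y] [NormedSpace ℝ Y] [Lattice Y] [BanachLattice Y]

theorem evalHom_mem_evalSublattice (x : L) : evalHom L x ∈ (evalSublattice L).carrier :=
  VectorSublattice.subset_closedGen _ ⟨x, rfl⟩

theorem graph_mem_liftGraph (T : LatticeHom L X) (x : L) :
    (evalHom L x, T x) ∈ (liftGraph T).carrier :=
  VectorSublattice.subset_closedGen _ ⟨x, rfl⟩

theorem isClosed_liftGraph (T : LatticeHom L X) : IsClosed (liftGraph T).carrier :=
  VectorSublattice.isClosed_closedGen _

theorem liftGraph_functional {T : LatticeHom L X} (hT : IsNormBounded T) {f : C(UnitDual L, ℝ)}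
    {u v : X} (hu : (f, u) ∈ (liftGraph T).carrier) (hv : (f, v) ∈ (liftGraph T).carrier) :
    u = v := by
  obtain ⟨C, hC⟩ := hT
  have h := norm_snd_le_of_mem_liftGraph (fun x => hC ⟨x, rfl⟩)
    ((liftGraph T).toSubmodule.sub_mem hu hv)
  simp only [Prod.snd_sub, Prod.fst_sub, sub_self, norm_zero, mul_zero] at h
  exact sub_eq_zero.1 (norm_le_zero_iff.1 h)

/-- By the estimate, the first projection is bounded below on the complete graph. Its range is
therefore closed, and it contains the evaluations. -/
theorem exists_mem_liftGraph {T : LatticeHom L X} (hT : IsNormBounded T) {f : C(UnitDual L, ℝ)}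
    (hf : f ∈ (evalSublattice L).carrier) : ∃ u, (f, u) ∈ (liftGraph T).carrier := by
  obtain ⟨C, hC⟩ := hT
  let π := LinearMap.fst ℝ C(UnitDual L, ℝ) X
  let W := (liftGraph T).map π fun _ _ => ⟨rfl, rfl⟩
  have hW : IsClosed W.carrier := by
    have : CompleteSpace (liftGraph T).toSubmodule :=
      IsClosed.completeSpace_coe (s := (liftGraph T).carrier) (hs := isClosed_liftGraph T)
    let g : (liftGraph T).toSubmodule →ₗ[ℝ] C(UnitDual L, ℝ) :=
      π ∘ₗ (liftGraph T).toSubmodule.subtype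
    have hg : AntilipschitzWith (Real.toNNReal (max 1 (2 * C))) g := by
      refine AddMonoidHomClass.antilipschitz_of_bound g fun z => ?_
      rw [Real.coe_toNNReal _ (zero_le_one.trans (le_max_left _ _))]
      have h2 := norm_snd_le_of_mem_liftGraph (fun x => hC ⟨x, rfl⟩) z.2
      refine max_le ?_ (h2.trans ?_)
      · exact le_mul_of_one_le_left (norm_nonneg _) (le_max_left _ _)
      · exact mul_le_mul_of_nonneg_right (le_max_right _ _) (norm_nonneg _)
    have hu : UniformContinuous g := uniformContinuous_fst.comp uniformContinuous_subtype_val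
    have hr : W.carrier = Set.range g := by
      ext f
      constructor
      · rintro ⟨z, hz, rfl⟩
        exact ⟨⟨z, hz⟩, rfl⟩
      · rintro ⟨z, rfl⟩
        exact ⟨z.1, z.2, rfl⟩
    rw [hr]
    exact hg.isClosed_range hu
  obtain ⟨⟨f, u⟩, hz, rfl⟩ := VectorSublattice.closedGen_subset (W := W) (by
    rintro _ ⟨x, rfl⟩
    exact ⟨_, graph_mem_liftGraph T x, rfl⟩) hW hf
  exact ⟨u, hz⟩

/-- The extension of `evalHom L` is the inclusion; this makes the supremum norm a lower bound for
the free norm. -/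
theorem diag_mem_liftGraph_evalHom {f : C(UnitDual L, ℝ)} (hf : f ∈ (evalSublattice L).carrier) :
    (f, f) ∈ (liftGraph (evalHom L)).carrier := by
  let W := (liftGraph (evalHom L)).comap (LinearMap.prod LinearMap.id LinearMap.id)
    fun _ _ => ⟨rfl, rfl⟩
  have hW : IsClosed W.carrier :=
    (isClosed_liftGraph (evalHom L)).preimage (continuous_id.prodMk continuous_id)
  refine VectorSublattice.closedGen_subset (W := W) ?_ hW hf
  rintro _ ⟨x, rfl⟩
  exact graph_mem_liftGraph (evalHom L) x

theorem map_mem_liftGraph {T : LatticeHom L X} {T' : LatticeHom L Y} {S : X →L[ℝ] Y}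
    (hS : IsBanachLatticeHom S) (h : ∀ x, T' x = S (T x)) {f : C(UnitDual L, ℝ)} {u : X}
    (hu : (f, u) ∈ (liftGraph T).carrier) : (f, S u) ∈ (liftGraph T').carrier := by
  let W := (liftGraph T').comap (LinearMap.prodMap LinearMap.id (S : X →ₗ[ℝ] Y))
    fun x y => ⟨Prod.ext rfl (hS x.2 y.2).1, Prod.ext rfl (hS x.2 y.2).2⟩
  have hW : IsClosed W.carrier :=
    (isClosed_liftGraph T').preimage (continuous_fst.prodMk (S.continuous.comp continuous_snd))
  refine VectorSublattice.closedGen_subset (W := W) ?_ hW hu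
  rintro _ ⟨x, rfl⟩
  change (evalHom L x, S (T x)) ∈ (liftGraph T').carrier
  rw [← h]
  exact graph_mem_liftGraph T' x

theorem isBanachLatticeHom_smul_id {c : ℝ} (hc : 0 < c) :
    IsBanachLatticeHom (c • ContinuousLinearMap.id ℝ X) := fun x y =>
  ⟨(OrderIso.smulRight hc).map_sup x y, (OrderIso.smulRight hc).map_inf x y⟩

/-- A Banach lattice homomorphism as a lattice homomorphism. -/
def IsBanachLatticeHom.toLatticeHom {S : X →L[ℝ] Y} (hS : IsBanachLatticeHom S) :
    LatticeHom X Y where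
  toFun := S
  map_sup' x y := (hS x y).1
  map_inf' x y := (hS x y).2

omit [NormedSpace ℝ X] [BanachLattice X] in
theorem norm_le_supNorm {T : LatticeHom L X} (hT : IsNormBounded T) (x : L) :
    ‖T x‖ ≤ supNorm T := le_ciSup hT x

omit [NormedSpace ℝ X] [BanachLattice X] in
theorem supNorm_nonneg (T : LatticeHom L X) : 0 ≤ supNorm T :=
  Real.iSup_nonneg fun _ => norm_nonneg _

end Lift

/-! ### The free Banach lattice -/

/-- The free Banach lattice generated by a lattice `L`. -/
def FreeBanachLattice (L : Type u) [Lattice L] : Type u := (evalSublattice L).toSubmodule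

namespace FreeBanachLattice

variable {L : Type u} [Lattice L]

noncomputable instance : AddCommGroup (FreeBanachLattice L) :=
  inferInstanceAs (AddCommGroup (evalSublattice L).toSubmodule)

noncomputable instance : Module ℝ (FreeBanachLattice L) :=
  inferInstanceAs (Module ℝ (evalSublattice L).toSubmodule)

noncomputable instance : Lattice (FreeBanachLattice L) :=
  inferInstanceAs (Lattice (evalSublattice L).toSubmodule)

instance : IsOrderedAddMonoid (FreeBanachLattice L) :=
  inferInstanceAs (IsOrderedAddMonoid (evalSublattice L).toSubmodule)

instance : IsOrderedModule ℝ (FreeBanachLattice L) :=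
  inferInstanceAs (IsOrderedModule ℝ (evalSublattice L).toSubmodule)

/-- The underlying continuous function of an element of the free Banach lattice. -/
noncomputable def toFun : FreeBanachLattice L →ₗ[ℝ] C(UnitDual L, ℝ) :=
  (evalSublattice L).toSubmodule.subtype

theorem toFun_mem (f : FreeBanachLattice L) : f.toFun ∈ (evalSublattice L).carrier :=
  Subtype.property (p := (· ∈ (evalSublattice L).toSubmodule)) f

/-! ### The norm of the free Banach lattice -/

/-- The norms of the images of `f` under the extensions of the contractive lattice homomorphisms
on `L`. -/
def liftNorms (f : FreeBanachLattice L) : Set ℝ :=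
  {r | ∃ (X : Type u) (_ : NormedAddCommGroup X) (_ : NormedSpace ℝ X) (_ : Lattice X)
    (_ : BanachLattice X) (T : LatticeHom L X) (u : X), (∀ x, ‖T x‖ ≤ 1) ∧
      (f.toFun, u) ∈ (liftGraph T).carrier ∧ ‖u‖ = r}

/-- With this norm every extension of a contractive homomorphism is contractive; the supremum norm
yields only the constant 2. -/
noncomputable instance : Norm (FreeBanachLattice L) := ⟨fun f => sSup (liftNorms f)⟩

theorem two_mul_norm_mem_upperBounds (f : FreeBanachLattice L) :
    2 * ‖f.toFun‖ ∈ upperBounds (liftNorms f) := by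
  rintro _ ⟨X, _, _, _, _, T, u, hT, hu, rfl⟩
  simpa using norm_snd_le_of_mem_liftGraph hT hu

theorem norm_toFun_mem_liftNorms (f : FreeBanachLattice L) : ‖f.toFun‖ ∈ liftNorms f :=
  ⟨_, _, _, _, inferInstance, evalHom L, f.toFun, norm_evalHom_le,
    diag_mem_liftGraph_evalHom f.toFun_mem, rfl⟩

theorem norm_le_two_mul (f : FreeBanachLattice L) : ‖f‖ ≤ 2 * ‖f.toFun‖ :=
  csSup_le ⟨_, norm_toFun_mem_liftNorms f⟩ (two_mul_norm_mem_upperBounds f)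

theorem norm_toFun_le (f : FreeBanachLattice L) : ‖f.toFun‖ ≤ ‖f‖ :=
  le_csSup ⟨_, two_mul_norm_mem_upperBounds f⟩ (norm_toFun_mem_liftNorms f)

theorem norm_le_of_mem_liftGraph {X : Type u} [NormedAddCommGroup X] [NormedSpace ℝ X] [Lattice X]
    [BanachLattice X] {T : LatticeHom L X} (hT : ∀ x, ‖T x‖ ≤ 1) {f : FreeBanachLattice L} {u : X}
    (hu : (f.toFun, u) ∈ (liftGraph T).carrier) : ‖u‖ ≤ ‖f‖ :=
  le_csSup ⟨_, two_mul_norm_mem_upperBounds f⟩ ⟨X, _, _, _, _, T, u, hT, hu, rfl⟩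

theorem norm_le_of_forall {f : FreeBanachLattice L} {B : ℝ}
    (h : ∀ (X : Type u) [NormedAddCommGroup X] [NormedSpace ℝ X] [Lattice X] [BanachLattice X]
      (T : LatticeHom L X) (u : X), (∀ x, ‖T x‖ ≤ 1) →
        (f.toFun, u) ∈ (liftGraph T).carrier → ‖u‖ ≤ B) : ‖f‖ ≤ B :=
  csSup_le ⟨_, norm_toFun_mem_liftNorms f⟩ (by
    rintro _ ⟨X, _, _, _, _, T, u, hT, hu, rfl⟩
    exact h X T u hT hu)

theorem isNormBounded_of_norm_le {X : Type*} [NormedAddCommGroup X] [Lattice X]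
    {T : LatticeHom L X} {C : ℝ} (hT : ∀ x, ‖T x‖ ≤ C) : IsNormBounded T :=
  ⟨C, Set.forall_mem_range.2 hT⟩

theorem exists_lift_norm_le {X : Type u} [NormedAddCommGroup X] [NormedSpace ℝ X] [Lattice X]
    [BanachLattice X] {T : LatticeHom L X} (hT : ∀ x, ‖T x‖ ≤ 1) (f : FreeBanachLattice L) :
    ∃ u, (f.toFun, u) ∈ (liftGraph T).carrier ∧ ‖u‖ ≤ ‖f‖ := by
  obtain ⟨u, hu⟩ := exists_mem_liftGraph (isNormBounded_of_norm_le hT) f.toFun_mem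
  exact ⟨u, hu, norm_le_of_mem_liftGraph hT hu⟩

theorem norm_smul_le_mul (c : ℝ) (f : FreeBanachLattice L) : ‖c • f‖ ≤ ‖c‖ * ‖f‖ := by
  refine norm_le_of_forall fun X _ _ _ _ T u hT hu => ?_
  obtain ⟨v, hv, hvf⟩ := exists_lift_norm_le hT f
  rw [liftGraph_functional (isNormBounded_of_norm_le hT) hu
    ((liftGraph T).toSubmodule.smul_mem c hv), Prod.snd, norm_smul]
  exact mul_le_mul_of_nonneg_left hvf (norm_nonneg c)

theorem core : NormedSpace.Core ℝ (FreeBanachLattice L) where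
  norm_nonneg f := (norm_nonneg _).trans (norm_toFun_le f)
  norm_smul c f := by
    refine le_antisymm (norm_smul_le_mul c f) ?_
    rcases eq_or_ne c 0 with rfl | hc
    · rw [norm_zero, zero_mul]
      exact (norm_nonneg _).trans (norm_toFun_le _)
    · have h := norm_smul_le_mul c⁻¹ (c • f)
      rw [smul_smul, inv_mul_cancel₀ hc, one_smul, norm_inv] at h
      rwa [← le_inv_mul_iff₀ (norm_pos_iff.2 hc)]
  norm_triangle f g := by
    refine norm_le_of_forall fun X _ _ _ _ T u hT hu => ?_
    obtain ⟨v, hv, hvf⟩ := exists_lift_norm_le hT f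
    obtain ⟨w, hw, hwg⟩ := exists_lift_norm_le hT g
    rw [liftGraph_functional (isNormBounded_of_norm_le hT) hu
      ((liftGraph T).toSubmodule.add_mem hv hw)]
    exact (norm_add_le v w).trans (add_le_add hvf hwg)
  norm_eq_zero_iff f := by
    constructor
    · intro h
      have h0 : f.toFun = 0 := norm_le_zero_iff.1 (h ▸ norm_toFun_le f)
      exact Subtype.ext h0
    · rintro rfl
      refine le_antisymm ((norm_le_two_mul 0).trans (by simp)) ?_
      exact (norm_nonneg _).trans (norm_toFun_le _)

noncomputable instance : NormedAddCommGroup (FreeBanachLattice L) := .ofCore core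

noncomputable instance : NormedSpace ℝ (FreeBanachLattice L) := .ofCore core

/-- The free Banach lattice is isomorphic to the closed vector sublattice of the space of continuous
functions which is generated by the evaluations. -/
noncomputable def equivEvalSublattice :
    FreeBanachLattice L ≃L[ℝ] (evalSublattice L).toSubmodule :=
  LinearEquiv.toContinuousLinearEquivOfBounds
    (LinearEquiv.refl ℝ (evalSublattice L).toSubmodule :
      FreeBanachLattice L ≃ₗ[ℝ] (evalSublattice L).toSubmodule) 1 2
    (fun f => (norm_toFun_le f).trans_eq (one_mul _).symm)
    (fun f => norm_le_two_mul (L := L) f)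

instance : BanachLattice (FreeBanachLattice L) where
  solid {f g} h := by
    refine norm_le_of_forall fun X _ _ _ _ T u hT hu => ?_
    obtain ⟨v, hv, hvg⟩ := exists_lift_norm_le hT g
    have habs {z} (hz : z ∈ (liftGraph T).carrier) : |z| ∈ (liftGraph T).carrier :=
      (liftGraph T).sup_mem hz ((liftGraph T).toSubmodule.neg_mem hz)
    -- The inequality `|f| ≤ |g|` is the equation `|f| ⊔ |g| = |g|`, which the graph transfers to
    -- `|u|` and `|v|`.
    have hs : (|g.toFun|, |u| ⊔ |v|) ∈ (liftGraph T).carrier := by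
      have h1 : |f.toFun| ⊔ |g.toFun| = |g.toFun| := sup_eq_right.2 h
      have h2 := (liftGraph T).sup_mem (habs hu) (habs hv)
      rw [← h1]
      exact h2
    have h3 := liftGraph_functional (isNormBounded_of_norm_le hT) hs (habs hv)
    exact (norm_le_norm_of_abs_le_abs (sup_eq_right.1 h3)).trans hvg
  toCompleteSpace := by
    have : CompleteSpace (evalSublattice L).toSubmodule :=
      IsClosed.completeSpace_coe (s := (evalSublattice L).carrier)
        (hs := VectorSublattice.isClosed_closedGen _)
    exact (completeSpace_congr (e := (equivEvalSublattice (L := L)).toEquiv)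
      equivEvalSublattice.isUniformEmbedding).2 this

/-! ### The universal property -/

/-- The canonical map from `L` to the free Banach lattice. -/
noncomputable def of (L : Type u) [Lattice L] : LatticeHom L (FreeBanachLattice L) where
  toFun x := ⟨evalHom L x, evalHom_mem_evalSublattice x⟩
  map_sup' x y := Subtype.ext (map_sup (evalHom L) x y)
  map_inf' x y := Subtype.ext (map_inf (evalHom L) x y)

theorem norm_of_le (x : L) : ‖of L x‖ ≤ 1 :=
  norm_le_of_forall fun X _ _ _ _ T u hT hu => by
    rw [liftGraph_functional (isNormBounded_of_norm_le hT) hu (graph_mem_liftGraph T x)]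
    exact hT x

theorem norm_le_supNorm_mul {X : Type u} [NormedAddCommGroup X] [NormedSpace ℝ X] [Lattice X]
    [BanachLattice X] {T : LatticeHom L X} (hT : IsNormBounded T) {f : FreeBanachLattice L} {u : X}
    (hu : (f.toFun, u) ∈ (liftGraph T).carrier) : ‖u‖ ≤ supNorm T * ‖f‖ := by
  -- If `supNorm T = 0`, the estimate with `C = 0` gives `u = 0`; otherwise `T` is rescaled to a
  -- contractive homomorphism.
  rcases (supNorm_nonneg T).eq_or_lt with h0 | hpos
  · have := norm_snd_le_of_mem_liftGraph (norm_le_supNorm hT) hu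
    simpa [← h0] using this
  · have hS := isBanachLatticeHom_smul_id (X := X) (inv_pos.2 hpos)
    have h := norm_le_of_mem_liftGraph (T := hS.toLatticeHom.comp T) (f := f) (fun x => ?_)
      (map_mem_liftGraph hS (fun _ => rfl) hu)
    · change ‖(supNorm T)⁻¹ • u‖ ≤ ‖f‖ at h
      rw [norm_smul, norm_inv, Real.norm_of_nonneg hpos.le] at h
      rwa [← inv_mul_le_iff₀ hpos]
    · change ‖(supNorm T)⁻¹ • T x‖ ≤ 1
      rw [norm_smul, norm_inv, Real.norm_of_nonneg hpos.le, inv_mul_le_iff₀ hpos, mul_one]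
      exact norm_le_supNorm hT x

theorem exists_lift {X : Type u} [NormedAddCommGroup X] [NormedSpace ℝ X] [Lattice X]
    [BanachLattice X] {T : LatticeHom L X} (hT : IsNormBounded T) :
    ∃ S : FreeBanachLattice L →L[ℝ] X, IsBanachLatticeHom S ∧ (∀ x, S (of L x) = T x) ∧
      ‖S‖ = supNorm T := by
  choose s hs using fun f : FreeBanachLattice L => exists_mem_liftGraph hT f.toFun_mem
  let S : FreeBanachLattice L →L[ℝ] X := LinearMap.mkContinuous
    { toFun := s
      map_add' f g := liftGraph_functional hT (hs (f + g))
        ((liftGraph T).toSubmodule.add_mem (hs f) (hs g))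
      map_smul' c f := liftGraph_functional hT (hs (c • f))
        ((liftGraph T).toSubmodule.smul_mem c (hs f)) }
    (supNorm T) fun f => norm_le_supNorm_mul hT (hs f)
  have hS (x : L) : S (of L x) = T x :=
    liftGraph_functional hT (hs (of L x)) (graph_mem_liftGraph T x)
  refine ⟨S, fun f g => ⟨?_, ?_⟩, hS, le_antisymm ?_ ?_⟩
  · exact liftGraph_functional hT (hs (f ⊔ g)) ((liftGraph T).sup_mem (hs f) (hs g))
  · exact liftGraph_functional hT (hs (f ⊓ g)) ((liftGraph T).inf_mem (hs f) (hs g))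
  · exact LinearMap.mkContinuous_norm_le _ (supNorm_nonneg T) _
  · refine Real.iSup_le (fun x => ?_) (norm_nonneg S)
    rw [← hS x]
    exact (S.le_opNorm _).trans (mul_le_of_le_one_right (norm_nonneg S) (norm_of_le x))

/-- The coincidence set is a closed sublattice containing the generators. Its closedness is carried
to `C(K)` through the equivalence of the two norms. -/
theorem lift_ext {X : Type*} [NormedAddCommGroup X] [NormedSpace ℝ X] [Lattice X]
    {S S' : FreeBanachLattice L →L[ℝ] X} (hS : IsBanachLatticeHom S) (hS' : IsBanachLatticeHom S')
    (h : ∀ x, S (of L x) = S' (of L x)) : S = S' := by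
  let e := equivEvalSublattice (L := L)
  let E : VectorSublattice (FreeBanachLattice L) :=
    { toSubmodule := LinearMap.eqLocus (S : FreeBanachLattice L →ₗ[ℝ] X) S'
      sup_mem := fun {x y} hx hy => by
        have hx : S x = S' x := hx
        have hy : S y = S' y := hy
        change S (x ⊔ y) = S' (x ⊔ y)
        rw [(hS x y).1, (hS' x y).1, hx, hy]
      inf_mem := fun {x y} hx hy => by
        have hx : S x = S' x := hx
        have hy : S y = S' y := hy
        change S (x ⊓ y) = S' (x ⊓ y)
        rw [(hS x y).2, (hS' x y).2, hx, hy] }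
  have hE : IsClosed E.carrier := isClosed_eq S.continuous S'.continuous
  have hcl : IsClosed (E.map toFun fun _ _ => ⟨rfl, rfl⟩).carrier := by
    have h1 : IsClosed (e '' E.carrier) := e.toHomeomorph.isClosedMap _ hE
    have h2 := (VectorSublattice.isClosed_closedGen
      (Set.range (evalHom L))).isClosedEmbedding_subtypeVal.isClosedMap _ h1
    have h3 := Set.image_image (Subtype.val : _ → C(UnitDual L, ℝ)) e E.carrier
    exact Eq.subst (motive := IsClosed) h3 h2
  ext f
  obtain ⟨g, hg, hgf⟩ := VectorSublattice.closedGen_subset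
    (W := E.map toFun fun _ _ => ⟨rfl, rfl⟩) (by
      rintro _ ⟨x, rfl⟩
      exact ⟨of L x, h x, rfl⟩) hcl f.toFun_mem
  obtain rfl : g = f := Subtype.ext hgf
  exact hg

theorem isFreeBanachLattice_of (L : Type u) [Lattice L] : IsFreeBanachLattice (of L) where
  isNormBounded := isNormBounded_of_norm_le norm_of_le
  exists_unique_lift X _ _ _ _ T hT := by
    obtain ⟨S, hS, h, hn⟩ := exists_lift hT
    exact ⟨S, hS, h, hn, fun S' hS' h' => lift_ext hS' hS fun x => (h' x).trans (h x).symm⟩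

end FreeBanachLattice

/-! ### Uniqueness and representation -/

namespace IsFreeBanachLattice

variable {L F : Type u} [Lattice L] [NormedAddCommGroup F] [NormedSpace ℝ F] [Lattice F]
  [BanachLattice F] {δ : LatticeHom L F}

theorem eq_id (hδ : IsFreeBanachLattice δ) {S : F →L[ℝ] F} (hS : IsBanachLatticeHom S)
    (h : ∀ x, S (δ x) = δ x) : S = ContinuousLinearMap.id ℝ F := by
  obtain ⟨_, _, _, _, huniq⟩ := hδ.exists_unique_lift F δ hδ.isNormBounded
  exact (huniq S hS h).trans (huniq _ (fun _ _ => ⟨rfl, rfl⟩) fun _ => rfl).symm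

/-- Two free Banach lattices generated by the same lattice are lattice isomorphic. -/
theorem exists_equiv {F' : Type u} [NormedAddCommGroup F'] [NormedSpace ℝ F'] [Lattice F']
    [BanachLattice F'] {δ' : LatticeHom L F'} (hδ : IsFreeBanachLattice δ)
    (hδ' : IsFreeBanachLattice δ') :
    ∃ e : F ≃L[ℝ] F', IsBanachLatticeHom (e : F →L[ℝ] F') := by
  obtain ⟨S, hS, h, -, -⟩ := hδ.exists_unique_lift F' δ' hδ'.isNormBounded
  obtain ⟨S', hS', h', -, -⟩ := hδ'.exists_unique_lift F δ hδ.isNormBounded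
  have h1 : S'.comp S = .id ℝ F := hδ.eq_id (fun x y => by simp [(hS x y).1, (hS x y).2,
    (hS' (S x) (S y)).1, (hS' (S x) (S y)).2]) fun x => by simp [h, h']
  have h2 : S.comp S' = .id ℝ F' := hδ'.eq_id (fun x y => by simp [(hS' x y).1, (hS' x y).2,
    (hS (S' x) (S' y)).1, (hS (S' x) (S' y)).2]) fun x => by simp [h, h']
  exact ⟨ContinuousLinearEquiv.equivOfInverse S S' (fun x => congr($h1 x))
    (fun x => congr($h2 x)), hS⟩

/-- Every free Banach lattice is lattice isomorphic to the closed vector sublattice generated by the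
evaluations. -/
theorem exists_equiv_evalSublattice (hδ : IsFreeBanachLattice δ) :
    ∃ e : F ≃L[ℝ] (evalSublattice L).toSubmodule,
      ∀ x y, e (x ⊔ y) = e x ⊔ e y ∧ e (x ⊓ y) = e x ⊓ e y := by
  obtain ⟨e, he⟩ := hδ.exists_equiv (FreeBanachLattice.isFreeBanachLattice_of L)
  exact ⟨e.trans FreeBanachLattice.equivEvalSublattice, fun x y =>
    ⟨congrArg FreeBanachLattice.equivEvalSublattice (he x y).1,
      congrArg FreeBanachLattice.equivEvalSublattice (he x y).2⟩⟩

/-- The target carries the supremum norm, not the free norm, and inherits the maximum identity from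
`C(K)`. -/
theorem isIsomorphicToAMSpace (hδ : IsFreeBanachLattice δ) : IsIsomorphicToAMSpace F := by
  obtain ⟨e, he⟩ := hδ.exists_equiv_evalSublattice
  exact ⟨(evalSublattice L).toSubmodule, _, _, _,
    (evalSublattice L).banachLattice (VectorSublattice.isClosed_closedGen _),
    fun x y hx hy _ => norm_sup_eq_max (f := x.1) (g := y.1) hx hy, e, he⟩

theorem isIsomorphicToSublatticeOfCK (hδ : IsFreeBanachLattice δ) :
    IsIsomorphicToSublatticeOfCK F := by
  obtain ⟨e, he⟩ := hδ.exists_equiv_evalSublattice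
  exact ⟨UnitDual L, _, inferInstance, inferInstance, (evalSublattice L).toSubmodule,
    VectorSublattice.isClosed_closedGen _,
    fun f hf g hg => ⟨(evalSublattice L).sup_mem hf hg, (evalSublattice L).inf_mem hf hg⟩, e,
    fun x y => ⟨congrArg Subtype.val (he x y).1, congrArg Subtype.val (he x y).2⟩⟩

end IsFreeBanachLattice

/-- The free Banach lattice generated by an arbitrary lattice `L` exists, and it is lattice
isomorphic to an AM-space and to a sublattice of a `C(K)`-space. -/
theorem theorem3p9 (L : Type u) [Lattice L] :
    (∃ (F : Type u) (_ : NormedAddCommGroup F) (_ : NormedSpace ℝ F) (_ : Lattice F)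
      (_ : BanachLattice F) (δ : LatticeHom L F), IsFreeBanachLattice δ) ∧
    ∀ (F : Type u) [NormedAddCommGroup F] [NormedSpace ℝ F] [Lattice F] [BanachLattice F]
      (δ : LatticeHom L F), IsFreeBanachLattice δ →
        IsIsomorphicToAMSpace F ∧ IsIsomorphicToSublatticeOfCK F :=
  ⟨⟨FreeBanachLattice L, _, _, _, inferInstance, FreeBanachLattice.of L,
    FreeBanachLattice.isFreeBanachLattice_of L⟩,
    fun _ _ _ _ _ _ hδ => ⟨hδ.isIsomorphicToAMSpace, hδ.isIsomorphicToSublatticeOfCK⟩⟩
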